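/- Let $T|S$ and $U|T$ be finite, purely (i.e. totally) ramified extensions of discrete valuation rings of residue characteristic a prime $p$, with fields of fractions $K=\mathrm{frac}\,S$, $L=\mathrm{frac}\,T$, $E=\mathrm{frac}\,U$. Suppose that $E|K$ is Galois with group $H$ and that $L|K$ is Galois with group $G$; let $N=\mathrm{Gal}(E|L)$ and $n=|N|=[E:L]$. Let $u$ generate the maximal ideal of $U$. The twisted group ring $T\wr G=\{\sum_{\rho\in G}y_\rho\,\rho : y_\rho\in T\}$ carries the multiplication $(y\rho)(z\tau)=y\,\rho(z)\,\rho\tau$; the Wedderburn map is the $S$-algebra homomorphism $\omega':T\wr G\to\mathrm{End}_S T$, $y\rho\mapsto(x\mapsto y\,\rho(x))$, with image $\Xi'$. Likewise $\omega:U\wr H\to\mathrm{End}_S U$, with image $\Xi$. (Maps are written on the left.) The ring $T$ operates on $\mathrm{End}_S T$ and on $\mathrm{End}_T U$ by $(z\cdot f)(x)=z\,f(x)$, and $\Xi'$ is a $T$-submodule of $\mathrm{End}_S T$. Let $$\Lambda''=\{f\in\mathrm{End}_T U : f(u^k)\in Uu^k\text{ for all }k\ge 0\}.$$ Let $V\subseteq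 U$ be the $S$-linear span of $u^0,\dots,u^{n-1}$. Then multiplication is an isomorphism $T\otimes_S V\to U$, whence isomorphisms $\mathrm{End}_S T\otimes_S\mathrm{End}_S V\cong\mathrm{End}_S U$ and $\psi:T\otimes_S\mathrm{End}_S V\cong\mathrm{End}_T U$, and the composite $$\theta:\ \mathrm{End}_S T\otimes_T\mathrm{End}_T U\ \cong\ \mathrm{End}_S T\otimes_T(T\otimes_S\mathrm{End}_S V)\ \cong\ \mathrm{End}_S T\otimes_S\mathrm{End}_S V\ \cong\ \mathrm{End}_S U,$$ which satisfies $\theta(\alpha\otimes\beta)(xy)=\alpha(x)\beta(y)$ for $x\in T$, $y\in V$. Regard $\mathrm{End}_S T\otimes_T\mathrm{End}_T U$ as an $S$-algebra by transport of structure along $\theta$. If $p$ does not divide $n$, then $\omega$ is injective, the natural map $\Xi'\otimes_T\Lambda''\to\mathrm{End}_S T\otimes_T\mathrm{End}_T U$ is injective, and, identifying $\Xi'\otimes_T\Lambda''$ with its image, $$\theta^{-1}(\Xi)=\Xi'\otimes_T\Lambda''.$$ In other words, $\Xi'\otimes_T\Lambda''$ is an $S$-subalgebra of $\mathrm{End}_S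 T\otimes_T\mathrm{End}_T U$, and $\omega$ factors as an isomorphism of $S$-algebras $U\wr H\to\Xi'\otimes_T\Lambda''$ followed by the inclusion into $\mathrm{End}_S T\otimes_T\mathrm{End}_T U$ and $\theta$. (This is the Nebe decomposition of $U\wr H$.) -/

import Mathlib

open scoped TensorProduct

/-!
Maps are written on the left, so composition in `Module.End` reads from right to left, and the
twisted group ring is Mathlib's `SkewMonoidAlgebra`, with `(y ρ) (z τ) = y ρ(z) (ρ τ)`. Writing maps
and group operations on the right instead replaces all rings below by their opposites; the
underlying modules, maps and images stay the same.
-/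

namespace NebeDecomposition

section PurelyRamified

/-- A finite extension `T | S` of discrete valuation rings is purely (that is, totally) ramified if
its ramification index equals its degree: `s T = t ^ [T : S] T`, where `s` and `t` generate the
maximal ideals of `S` and `T`. -/
def IsPurelyRamified (S T : Type*) [CommRing S] [CommRing T] [IsLocalRing S] [IsLocalRing T]
    [Algebra S T] : Prop :=
  (IsLocalRing.maximalIdeal S).map (algebraMap S T) =
    IsLocalRing.maximalIdeal T ^ Module.finrank S T

variable {T U : Type*} [CommRing T] [CommRing U] [IsDomain T] [IsDomain U]
  [IsDiscreteValuationRing T] [IsDiscreteValuationRing U] [Algebra T U] [FaithfulSMul T U]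
  [Module.Finite T U]

theorem exists_powerBasis {n : ℕ} (hn : Module.finrank T U = n) (h : IsPurelyRamified T U)
    {u : U} (hu : Irreducible u) :
    ∃ b : Module.Basis (Fin n) T U, ∀ j, b j = u ^ (j : ℕ) := by
  classical
  have hm : ∀ c ∈ IsLocalRing.maximalIdeal T, u ^ n ∣ algebraMap T U c := by
    intro c hc
    have h1 := Ideal.mem_map_of_mem (algebraMap T U) hc
    rw [h, hn, hu.maximalIdeal_eq, Ideal.span_singleton_pow, Ideal.mem_span_singleton] at h1
    exact h1
  let k := IsLocalRing.ResidueField T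
  have hli : LinearIndependent k (fun j : Fin n ↦ (1 : k) ⊗ₜ[T] (u ^ (j : ℕ))) := by
    rw [Fintype.linearIndependent_iff]
    intro g hg
    choose c hc using fun i ↦ IsLocalRing.residue_surjective (R := T) (g i)
    have hsum : (∑ i, c i • u ^ (i : ℕ)) ∈ LinearMap.ker (TensorProduct.mk T k U 1) := by
      rw [LinearMap.mem_ker, TensorProduct.mk_apply, TensorProduct.tmul_sum, ← hg]
      refine Finset.sum_congr rfl fun i _ ↦ ?_
      rw [← hc i, TensorProduct.smul_tmul', TensorProduct.tmul_smul, TensorProduct.smul_tmul']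
      congr 1

    have hker : LinearMap.ker (TensorProduct.mk T k U 1) =
        IsLocalRing.maximalIdeal T • (⊤ : Submodule T U) :=
      LinearMap.ker_tensorProductMk (Q := U) (I := IsLocalRing.maximalIdeal T)
    rw [hker] at hsum
    have hdvd : u ^ n ∣ ∑ i, c i • u ^ (i : ℕ) := by
      refine Submodule.smul_induction_on hsum ?_ ?_
      · intro r hr x _
        rw [Algebra.smul_def]
        exact Dvd.dvd.mul_right (hm r hr) x
      · intro x y hx hy
        exact dvd_add hx hy
    have key : ∀ m : ℕ, ∀ hmn : m < n, c ⟨m, hmn⟩ ∈ IsLocalRing.maximalIdeal T := by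
      intro m
      induction m using Nat.strong_induction_on with
      | _ m ih =>
      intro hmn
      by_contra hcu
      have hunit : IsUnit (c ⟨m, hmn⟩) := by simpa using hcu
      have h2 : u ^ (m + 1) ∣ ∑ i ∈ Finset.univ.erase (⟨m, hmn⟩ : Fin n), c i • u ^ (i : ℕ) := by
        refine Finset.dvd_sum fun i hi ↦ ?_
        rw [Algebra.smul_def]
        rcases lt_or_ge (i : ℕ) m with hlt | hge
        · exact Dvd.dvd.mul_right ((pow_dvd_pow u hmn).trans (hm _ (ih i hlt i.2))) _
        · have : (i : ℕ) ≠ m := fun hh ↦ (Finset.mem_erase.1 hi).1 (Fin.ext hh)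
          exact Dvd.dvd.mul_left (pow_dvd_pow u (by omega)) _
      have h3 : u ^ (m + 1) ∣ c ⟨m, hmn⟩ • u ^ m := by
        have h4 := (pow_dvd_pow u hmn).trans hdvd
        rw [← Finset.add_sum_erase _ _ (Finset.mem_univ (⟨m, hmn⟩ : Fin n))] at h4
        exact (dvd_add_left h2).1 h4
      rw [Algebra.smul_def, pow_succ', mul_dvd_mul_iff_right (pow_ne_zero _ hu.ne_zero)] at h3
      exact hu.not_isUnit (isUnit_of_dvd_unit h3 (hunit.map _))
    intro i
    rw [← hc i, IsLocalRing.residue_eq_zero_iff]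
    exact key i i.2
  have hcard : Fintype.card (Fin n) = Module.finrank k (k ⊗[T] U) := by
    rw [Module.finrank_baseChange, hn, Fintype.card_fin]
  rcases Nat.eq_zero_or_pos n with rfl | hpos
  · exact absurd hn (Module.finrank_pos (R := T) (M := U)).ne'
  have : Nonempty (Fin n) := ⟨⟨0, hpos⟩⟩
  have hspan := IsLocalRing.span_eq_top_of_tmul_eq_basis (R := T) (fun j : Fin n ↦ u ^ (j : ℕ))
    (basisOfLinearIndependentOfCardEqFinrank hli hcard) (by simp)
  have hli' := linearIndependent_of_top_le_span_of_card_eq_finrank hspan.ge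
    (by rw [hn, Fintype.card_fin])
  exact ⟨Module.Basis.mk hli' hspan.ge, by simp⟩

/-- The `S`-linear span `V` of `u ^ 0, …, u ^ (n - 1)` in `U`. -/
def powerSpan (S : Type*) {U : Type*} [CommRing S] [CommRing U] [Algebra S U] (u : U) (n : ℕ) :
    Submodule S U :=
  Submodule.span S (Set.range fun j : Fin n ↦ u ^ (j : ℕ))

/-- The multiplication map `T ⊗_S V → U` is bijective. -/
theorem isBaseChange_powerSpan {S : Type*} [CommRing S] [Algebra S T] [Algebra S U]
    [IsScalarTower S T U] [FaithfulSMul S T]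
    {n : ℕ} (hn : Module.finrank T U = n) (h : IsPurelyRamified T U)
    {u : U} (hu : Irreducible u) : IsBaseChange T (powerSpan S u n).subtype := by
  obtain ⟨b, hb⟩ := exists_powerBasis hn h hu
  have hli : LinearIndependent S (fun j : Fin n ↦ u ^ (j : ℕ)) := by
    have := b.linearIndependent.restrict_scalars (R := S) (by
      intro x y hxy
      simpa [Algebra.smul_def] using hxy)
    convert this with j
    exact (hb j).symm
  let bV : Module.Basis (Fin n) S (powerSpan S u n) := Module.Basis.span hli
  have hbV : ∀ j, ((bV j : powerSpan S u n) : U) = u ^ (j : ℕ) := fun j ↦ by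
    exact congrArg Subtype.val (Module.Basis.span_apply hli j)
  refine IsBaseChange.of_equiv ((bV.baseChange T).equiv b (Equiv.refl _)) fun x ↦ ?_
  let f : powerSpan S u n →ₗ[S] U :=
    ((((bV.baseChange T).equiv b (Equiv.refl _)).toLinearMap.restrictScalars S) ∘ₗ
      TensorProduct.mk S T _ 1)
  suffices f = (powerSpan S u n).subtype from LinearMap.congr_fun this x
  refine bV.ext fun j ↦ ?_
  have h1 : f (bV j) = (bV.baseChange T).equiv b (Equiv.refl _) (bV.baseChange T j) := by
    simp [f]
  rw [h1, Module.Basis.equiv_apply, Submodule.subtype_apply, hbV]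
  simp [hb]

theorem finrank_eq_card (L E : Type*) [Field L] [Field E] [Algebra L E] [Algebra T L] [Algebra U E]
    [Algebra T E] [IsScalarTower T U E] [IsScalarTower T L E] [IsFractionRing T L]
    [IsFractionRing U E] [IsGalois L E] : Module.finrank T U = Nat.card Gal(E/L) := by
  have h : Module.finrank L E = Module.finrank T U := IsFractionRing.finrank_eq T L U E
  have hpos : 0 < Module.finrank T U := Module.finrank_pos
  have : FiniteDimensional L E := Module.finite_of_finrank_pos (h ▸ hpos)
  rw [IsGalois.card_aut_eq_finrank, h]

end PurelyRamified

section GaloisAction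

variable (S K L T : Type*) [CommRing S] [CommRing T] [Field K] [Field L] [Algebra S K] [Algebra T L]
  [IsFractionRing S K] [IsFractionRing T L] [Algebra S T] [Algebra K L] [Algebra S L]
  [IsScalarTower S K L] [IsScalarTower S T L] [IsIntegrallyClosed S] [IsIntegralClosure T S L]
  [Algebra.IsAlgebraic K L]

/-- The operation of `Gal(L/K)` on `T`, by restriction of its operation on `L`. -/
@[reducible]
noncomputable def galAction : MulSemiringAction Gal(L/K) T :=
  IsIntegralClosure.MulSemiringAction S K L T

theorem galAction_smulCommClass :
    letI := galAction S K L T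
    SMulCommClass Gal(L/K) S T := by
  let _ := galAction S K L T
  refine ⟨fun σ a x ↦ ?_⟩
  exact map_smul (galRestrict S K L T σ) a x

end GaloisAction

section Wedderburn

variable (S T G : Type*) [CommRing S] [CommRing T] [Algebra S T] [Group G]
  [MulSemiringAction G T] [SMulCommClass G S T]

/-- The Wedderburn map `ω : T ≀ G → End_S T`, sending `y ∈ T` to the multiplication by `y` and
`ρ ∈ G` to the operation of `ρ` on `T`. -/
noncomputable def wedderburn : SkewMonoidAlgebra T G →ₐ[S] Module.End S T :=
  SkewMonoidAlgebra.liftNCAlgHom (Algebra.lmul S T) (DistribMulAction.toModuleEnd S T)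
    (by intro x y; ext z; simp [smul_mul'])

theorem wedderburn_single (ρ : G) (y x : T) :
    wedderburn S T G (SkewMonoidAlgebra.single ρ y) x = y * ρ • x := by
  have h : wedderburn S T G (SkewMonoidAlgebra.single ρ y) =
      Algebra.lmul S T y * DistribMulAction.toModuleEnd S T ρ :=
    SkewMonoidAlgebra.liftNC_single _ _ _ _
  rw [h]
  simp

/-- The image `Ξ` of the Wedderburn map, as a subalgebra of `End_S T`. -/
noncomputable def wedderburnImage : Subalgebra S (Module.End S T) :=
  (wedderburn S T G).range

/-- The image `Ξ` of the Wedderburn map, as a `T`-submodule of `End_S T`; here `T` operates on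
`End_S T` by `(z • α)(x) = z α(x)`, that is, by composition with the multiplication by `z`. -/
noncomputable def wedderburnImageModule : Submodule T (Module.End S T) where
  carrier := wedderburnImage S T G
  zero_mem' := zero_mem _
  add_mem' := add_mem
  smul_mem' z α hα := by
    have h1 : z • α = Algebra.lmul S T z * α := by ext; simp
    have h2 : wedderburn S T G (SkewMonoidAlgebra.single 1 z) = Algebra.lmul S T z := by
      ext x; simp [wedderburn_single]
    rw [h1, ← h2]
    exact mul_mem (AlgHom.mem_range_self _ _) hα

end Wedderburn

/-- The triangular order `Λ'' ⊆ End_T U` of all `T`-linear endomorphisms of `U` that map `u ^ k`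
into `U u ^ k` for all `k ≥ 0`, as a `T`-submodule. -/
def triangularOrder (T : Type*) {U : Type*} [CommRing T] [CommRing U] [Algebra T U] (u : U) :
    Submodule T (Module.End T U) where
  carrier := {f | ∀ k : ℕ, f (u ^ k) ∈ Ideal.span {u ^ k}}
  zero_mem' k := by simp
  add_mem' hf hg k := by simpa using add_mem (hf k) (hg k)
  smul_mem' c f hf k := by
    rw [LinearMap.smul_apply, Algebra.smul_def]
    exact Ideal.mul_mem_left _ _ (hf k)

section Theta

variable {S T U : Type*} [CommRing S] [IsDomain S] [IsPrincipalIdealRing S] [CommRing T]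
  [CommRing U] [IsDomain T] [IsDomain U] [Algebra S T] [Algebra T U] [Algebra S U]
  [IsScalarTower S T U] [FaithfulSMul S T] [FaithfulSMul S U] [Module.Finite S T]
  [Module.Finite S U] {V : Submodule S U} (hV : IsBaseChange T V.subtype)

/-- For an `S`-submodule `V` of `U` such that `φ : T ⊗_S V → U`, `x ⊗ y ↦ x y`, is bijective, the
isomorphism `End_S T ⊗_S End_S V ≃ End_S (T ⊗_S V) ≃ End_S U`, `α ⊗ β₀ ↦ φ ∘ (α ⊗ β₀) ∘ φ⁻¹`. -/
noncomputable def thetaS : Module.End S T ⊗[S] Module.End S V ≃ₗ[S] Module.End S U :=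
  homTensorHomEquiv S T V T V ≪≫ₗ (hV.equiv.restrictScalars S).conj

/-- The isomorphism `ψ : T ⊗_S End_S V ≃ End_T U`, which sends `1 ⊗ β₀` to the `T`-linear extension
`φ ∘ (1 ⊗ β₀) ∘ φ⁻¹` of `β₀`. -/
noncomputable def psi : T ⊗[S] Module.End S V ≃ₗ[T] Module.End T U :=
  hV.end.equiv

/-- The isomorphism `θ`, composed of
`End_S T ⊗_T End_T U ≃ End_S T ⊗_T (T ⊗_S End_S V) ≃ End_S T ⊗_S End_S V ≃ End_S U`. -/
noncomputable def theta : Module.End S T ⊗[T] Module.End T U ≃ₗ[S] Module.End S U :=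
  ((TensorProduct.congr (LinearEquiv.refl T (Module.End S T)) (psi hV).symm ≪≫ₗ
    TensorProduct.AlgebraTensorModule.cancelBaseChange S T T (Module.End S T)
      (Module.End S V)).restrictScalars S) ≪≫ₗ thetaS hV

theorem theta_tmul (α : Module.End S T) (β : Module.End T U) (x : T) (y : V) :
    theta hV (α ⊗ₜ β) (x • (y : U)) = α x • β y := by
  have hxy : (hV.equiv.restrictScalars S).symm (x • (y : U)) = x ⊗ₜ[S] y := by
    rw [LinearEquiv.symm_apply_eq]
    exact (hV.equiv_tmul x y).symm
  obtain ⟨t, rfl⟩ := (psi hV).surjective β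
  induction t using TensorProduct.induction_on with
  | zero =>
    rw [map_zero, TensorProduct.tmul_zero, LinearEquiv.map_zero, LinearMap.zero_apply,
      LinearMap.zero_apply, smul_zero]
  | add t₁ t₂ h₁ h₂ =>
    rw [map_add, TensorProduct.tmul_add, LinearEquiv.map_add, LinearMap.add_apply, h₁, h₂, LinearMap.add_apply,
      smul_add]
  | tmul z β₀ =>
    have h1 : theta hV (α ⊗ₜ psi hV (z ⊗ₜ β₀)) = thetaS hV ((z • α) ⊗ₜ β₀) := by
      simp [theta]
    have h2 : psi hV (z ⊗ₜ β₀) (y : U) = z • (β₀ y : U) := by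
      have h3 : psi hV (z ⊗ₜ β₀) = z • IsBaseChange.endHom hV β₀ := hV.end.equiv_tmul z β₀
      rw [h3, LinearMap.smul_apply]
      exact congrArg (z • ·) (IsBaseChange.endHom_comp_apply hV β₀ y)
    have h4 : thetaS hV ((z • α) ⊗ₜ β₀) (x • (y : U)) =
        hV.equiv ((z • α) x ⊗ₜ[S] β₀ y) := by
      simp only [thetaS, LinearEquiv.trans_apply, LinearEquiv.conj_apply_apply, hxy,
        homTensorHomEquiv_apply, TensorProduct.homTensorHomMap_apply, TensorProduct.map_tmul]
      rfl
    rw [h1, h2, h4, hV.equiv_tmul, LinearMap.smul_apply, smul_eq_mul, smul_smul, mul_comm z]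
    rfl

/-- `End_S T ⊗_T End_T U`, with the `S`-algebra structure transported from `End_S U` via `θ`. -/
def TransportedTensor (_ : IsBaseChange T V.subtype) : Type _ :=
  Module.End S T ⊗[T] Module.End T U

namespace TransportedTensor

noncomputable instance : AddCommGroup (TransportedTensor hV) :=
  inferInstanceAs (AddCommGroup (Module.End S T ⊗[T] Module.End T U))

noncomputable instance : Module S (TransportedTensor hV) :=
  inferInstanceAs (Module S (Module.End S T ⊗[T] Module.End T U))

noncomputable instance : Module T (TransportedTensor hV) :=
  inferInstanceAs (Module T (Module.End S T ⊗[T] Module.End T U))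

/-- `θ` on the transported algebra, as a linear equivalence. -/
noncomputable def thetaLin : TransportedTensor hV ≃ₗ[S] Module.End S U := theta hV

noncomputable instance : Mul (TransportedTensor hV) :=
  ⟨fun γ₁ γ₂ ↦ (thetaLin hV).symm (thetaLin hV γ₁ * thetaLin hV γ₂)⟩

noncomputable instance : One (TransportedTensor hV) :=
  ⟨(thetaLin hV).symm 1⟩

theorem thetaLin_mul (γ₁ γ₂ : TransportedTensor hV) :
    thetaLin hV (γ₁ * γ₂) = thetaLin hV γ₁ * thetaLin hV γ₂ :=
  (thetaLin hV).apply_symm_apply _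

theorem thetaLin_one : thetaLin hV 1 = 1 :=
  (thetaLin hV).apply_symm_apply _

noncomputable instance : Ring (TransportedTensor hV) where
  __ := (inferInstance : AddCommGroup (TransportedTensor hV))
  left_distrib a b c := (thetaLin hV).injective (by simp only [thetaLin_mul, map_add, mul_add])
  right_distrib a b c := (thetaLin hV).injective (by simp only [thetaLin_mul, map_add, add_mul])
  zero_mul a := (thetaLin hV).injective (by simp only [thetaLin_mul, map_zero, zero_mul])
  mul_zero a := (thetaLin hV).injective (by simp only [thetaLin_mul, map_zero, mul_zero])
  mul_assoc a b c := (thetaLin hV).injective (by simp only [thetaLin_mul, mul_assoc])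
  one_mul a := (thetaLin hV).injective (by simp only [thetaLin_mul, thetaLin_one, one_mul])
  mul_one a := (thetaLin hV).injective (by simp only [thetaLin_mul, thetaLin_one, mul_one])

noncomputable instance : Algebra S (TransportedTensor hV) :=
  Algebra.ofModule
    (fun r a b ↦ (thetaLin hV).injective (by simp only [thetaLin_mul, map_smul, smul_mul_assoc]))
    (fun r a b ↦ (thetaLin hV).injective (by simp only [thetaLin_mul, map_smul, mul_smul_comm]))

/-- `θ` as an isomorphism of `S`-algebras. -/
noncomputable def thetaAlg : TransportedTensor hV ≃ₐ[S] Module.End S U :=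
  AlgEquiv.ofLinearEquiv (thetaLin hV) (thetaLin_one hV) (thetaLin_mul hV)

/-- For `T`-submodules `X ⊆ End_S T` and `Y ⊆ End_T U`, the natural map
`X ⊗_T Y → End_S T ⊗_T End_T U`. -/
noncomputable def incl (X : Submodule T (Module.End S T)) (Y : Submodule T (Module.End T U)) :
    X ⊗[T] Y →ₗ[T] TransportedTensor hV :=
  TensorProduct.mapIncl X Y

end TransportedTensor

end Theta

end NebeDecomposition

/-! Everything is compared on the elements `x u^j` with `x ∈ T` and `j < n`, which span `U`
additively. Let `τ ∈ H` restrict to `ρ ∈ G`, and let `σ` run over `N`. The element `∑_σ y_σ (τσ)` of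
the twisted group ring sends `x u^j` to `ρ(x) ∑_σ y_σ (τσ(u))^j`, because `N` fixes `T`. The tensor
`zρ ⊗ β` sends it to `ρ(x) z β(u^j)`. So the coset `τN` accounts for the tensors with first factor
in `Tρ`, and `θ⁻¹(Ξ) = Ξ' ⊗ Λ''` becomes a statement about one system for each coset.

Given `yτ`, the matching `β` has `β(u^j) = y τ(u)^j` for `j < n`. It lies in `Λ''` since `τ(u)` is
associated to `u` and the exponents `j < n` suffice for membership
(`mem_triangularOrder_iff_forall_lt`).

Given `β ∈ Λ''`, the system `∑_σ y_σ (τσ(u))^j = z β(u^j)` has to be solved in `U`. After cancelling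
`u^j` it is a Vandermonde system in the units `τσ(u)/u`, solvable if these are distinct modulo `u`,
that is, if `N` acts faithfully on `uU/u²U`. Tameness enters only here: as `n` is a unit, no
nontrivial element of `N` fixes `u` modulo `u²` (`eq_one_of_mul_self_dvd_smul_sub`).

Injectivity of `ω` is Dedekind's independence of characters; injectivity of the inclusion of tensor
products is flatness of torsion-free modules over `T`. -/

namespace NebeDecomposition

/-! ### Purely ramified extensions and the triangular order -/

section PurelyRamified

variable {T U : Type*} [CommRing T] [CommRing U] [IsDomain T] [IsDomain U]
  [IsDiscreteValuationRing T] [IsDiscreteValuationRing U] [Algebra T U] [FaithfulSMul T U]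
  [Module.Finite T U]

/-- The residue field does not grow: in the basis of powers of `u`, only `u^0` is not divisible by
`u`. -/
theorem exists_eq_algebraMap_add_mul (h : IsPurelyRamified T U) {u : U} (hu : Irreducible u)
    (x : U) : ∃ (c : T) (y : U), x = algebraMap T U c + u * y := by
  obtain ⟨b, hb⟩ := exists_powerBasis rfl h hu
  suffices ∀ x ∈ Submodule.span T (Set.range b), ∃ (c : T) (y : U), x = algebraMap T U c + u * y
    from this x (by rw [b.span_eq]; trivial)
  intro x hx
  induction hx using Submodule.span_induction with
  | mem x hx =>
    obtain ⟨j, rfl⟩ := hx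
    rw [hb]
    rcases Nat.eq_zero_or_pos (j : ℕ) with hj | hj
    · exact ⟨1, 0, by simp [hj]⟩
    · exact ⟨0, u ^ ((j : ℕ) - 1), by rw [← pow_succ', Nat.sub_add_cancel hj]; simp⟩
  | zero => exact ⟨0, 0, by simp⟩
  | add x y _ _ hx hy =>
    obtain ⟨c, y, rfl⟩ := hx
    obtain ⟨d, z, rfl⟩ := hy
    exact ⟨c + d, y + z, by rw [map_add]; ring⟩
  | smul a x _ hx =>
    obtain ⟨c, y, rfl⟩ := hx
    exact ⟨a * c, a • y, by simp only [Algebra.smul_def, map_mul]; ring⟩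

omit [FaithfulSMul T U] [Module.Finite T U] in
theorem exists_associated_algebraMap (h : IsPurelyRamified T U) {u : U} (hu : Irreducible u) :
    ∃ t : T, Associated (algebraMap T U t) (u ^ Module.finrank T U) := by
  obtain ⟨t, ht⟩ := IsDiscreteValuationRing.exists_irreducible T
  refine ⟨t, ?_⟩
  have h1 := h
  rwa [IsPurelyRamified, ht.maximalIdeal_eq, hu.maximalIdeal_eq, Ideal.map_span,
    Set.image_singleton, Ideal.span_singleton_pow, Ideal.span_singleton_eq_span_singleton] at h1

/-- Since `u^n` is a uniformizer of `T` up to a unit of `U`, `T`-linearity reduces an exponent `k`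
to `k % n`. This makes endomorphisms defined on the power basis easy to test. -/
theorem mem_triangularOrder_iff_forall_lt (h : IsPurelyRamified T U) {u : U} (hu : Irreducible u)
    {f : Module.End T U} :
    f ∈ triangularOrder T u ↔ ∀ k < Module.finrank T U, u ^ k ∣ f (u ^ k) := by
  refine ⟨fun hf k _ ↦ Ideal.mem_span_singleton.1 (hf k), fun hf ↦ ?_⟩
  obtain ⟨t, e, he⟩ := exists_associated_algebraMap h hu
  set n := Module.finrank T U
  have hn : 0 < n := Module.finrank_pos
  have hpow : ∀ (q : ℕ) (x : U), u ^ (n * q) * x = (t ^ q) • ((e : U) ^ q * x) := fun q x ↦ by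
    rw [pow_mul, ← he, mul_pow, Algebra.smul_def, map_pow, mul_assoc]
  have hdvd : ∀ q : ℕ, u ^ (n * q) ∣ algebraMap T U (t ^ q) := fun q ↦ by
    rw [map_pow, pow_mul]
    exact pow_dvd_pow_of_dvd (Associated.symm ⟨e, he⟩).dvd q
  -- Descending induction on `r`, starting at `r = n`, where `u^n` can be traded for an element of
  -- `T`. The arbitrary factor `y` is needed to absorb the unit `e ^ q`, which need not lie in `T`.
  have key : ∀ m r, r + m = n → ∀ y, u ^ r ∣ f (u ^ r * y) := by
    intro m
    induction m with
    | zero =>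
      intro r hr y
      obtain rfl : r = n := hr
      have h1 := hpow 1 y
      have h2 := hdvd 1
      rw [mul_one] at h1 h2
      rw [h1, map_smul, Algebra.smul_def]
      exact h2.mul_right _
    | succ m ih =>
      intro r hr y
      obtain ⟨c, z, rfl⟩ := exists_eq_algebraMap_add_mul h hu y
      have h1 : u ^ r * (algebraMap T U c + u * z) = c • u ^ r + u ^ (r + 1) * z := by
        rw [Algebra.smul_def]; ring
      rw [h1, map_add, map_smul, Algebra.smul_def]
      exact dvd_add ((hf r (by omega)).mul_left _)
        ((pow_dvd_pow u r.le_succ).trans (ih (r + 1) (by omega) z))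
  intro k
  have hk : u ^ k = u ^ (n * (k / n)) * u ^ (k % n) := by rw [← pow_add, Nat.div_add_mod]
  have h1 : f (u ^ k) =
      algebraMap T U (t ^ (k / n)) * f (u ^ (k % n) * (e : U) ^ (k / n)) := by
    rw [hk, hpow, map_smul, Algebra.smul_def, mul_comm (u ^ (k % n))]
  rw [Ideal.mem_span_singleton, h1, hk]
  exact mul_dvd_mul (hdvd _)
    (key (n - k % n) (k % n) (Nat.add_sub_cancel' (Nat.mod_lt k hn).le) _)

end PurelyRamified

/-! ### Tame action on a uniformizer -/

section Tame

variable {T U : Type*} [CommRing T] [CommRing U] [IsDomain T] [IsDomain U]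
  [IsDiscreteValuationRing T] [IsDiscreteValuationRing U] [Algebra T U] [FaithfulSMul T U]
  [Module.Finite T U] {H : Type*} [Group H] [MulSemiringAction H U]

theorem associated_smul {u : U} (hu : Irreducible u) (g : H) : Associated u (g • u) := by
  have h : Irreducible (g • u) :=
    (MulEquiv.irreducible_iff (MulSemiringAction.toRingEquiv H U g)).2 hu
  exact IsDiscreteValuationRing.associated_of_irreducible U hu h

/-- An automorphism of `U` over `T` that fixes a uniformizer modulo its square fixes
every element `y` modulo `y u`. -/
theorem mul_dvd_smul_sub (h : IsPurelyRamified T U) {u : U} (hu : Irreducible u) {g : H}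
    (hg : ∀ x : T, g • algebraMap T U x = algebraMap T U x) (hgu : u * u ∣ g • u - u) (y : U) :
    y * u ∣ g • y - y := by
  -- Modulo `u`, every element comes from `T`, which `g` fixes.
  have h1 : ∀ c : U, u ∣ g • c - c := by
    intro c
    obtain ⟨a, z, rfl⟩ := exists_eq_algebraMap_add_mul h hu c
    obtain ⟨v, hv⟩ := associated_smul hu g
    rw [smul_add, hg, smul_mul', ← hv]
    exact ⟨v * g • z - z, by ring⟩
  have h2 : ∀ k, u ^ k * u ∣ g • u ^ k - u ^ k := by
    intro k
    induction k with
    | zero => simp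
    | succ k ih =>
      obtain ⟨a, ha⟩ := ih
      obtain ⟨b, hb⟩ := hgu
      rw [sub_eq_iff_eq_add] at ha hb
      rw [pow_succ, smul_mul', ha, hb]
      exact ⟨u * a * b + b + a, by ring⟩
  rcases eq_or_ne y 0 with rfl | hy
  · simp
  obtain ⟨k, c, rfl⟩ := IsDiscreteValuationRing.eq_unit_mul_pow_irreducible hy hu
  obtain ⟨a, ha⟩ := h1 c
  obtain ⟨b, hb⟩ := h2 k
  rw [smul_mul', sub_eq_iff_eq_add.1 hb]
  have hc : u ∣ g • (c : U) * (1 + u * b) - c := ⟨a + g • (c : U) * b, by linear_combination ha⟩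
  have h3 : (c : U) * u ^ k * u ∣ u ^ k * u := by
    rw [mul_assoc]
    exact (Units.mul_left_dvd).2 dvd_rfl
  refine h3.trans ?_
  obtain ⟨w, hw⟩ := hc
  exact ⟨w, by linear_combination u ^ k * hw⟩

/-- Put `x = g y - y`. The sum of `g^i x` over `i < n` telescopes to `g^n y - y = 0`, while each
`g^i x` is congruent to `x` modulo `x u`. Hence `x u` divides `n x`, and as `n` is a unit, `x = 0`.
-/
theorem eq_one_of_mul_self_dvd_smul_sub [FaithfulSMul H U] (h : IsPurelyRamified T U) {u : U}
    (hu : Irreducible u) {g : H} (hg : ∀ x : T, g • algebraMap T U x = algebraMap T U x) {n : ℕ}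
    (hn : IsUnit (n : U)) (hgn : g ^ n = 1) (hgu : u * u ∣ g • u - u) : g = 1 := by
  have h1 := mul_dvd_smul_sub h hu hg hgu
  have h2 : ∀ (y : U) (i : ℕ), y * u ∣ g ^ i • y - y := by
    intro y i
    induction i with
    | zero => simp
    | succ i ih =>
      have h3 := h1 (g ^ i • y)
      rw [smul_smul, ← pow_succ'] at h3
      obtain ⟨a, ha⟩ := ih
      have h4 : y * u ∣ g ^ i • y * u := ⟨1 + u * a, by linear_combination u * ha⟩
      simpa using dvd_add (h4.trans h3) ⟨a, ha⟩
  refine FaithfulSMul.eq_of_smul_eq_smul (α := U) fun y ↦ ?_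
  rw [one_smul, ← sub_eq_zero]
  set x := g • y - y with hx
  have h3 : ∑ i ∈ Finset.range n, g ^ i • x = 0 := by
    have h4 : ∀ i ∈ Finset.range n, g ^ i • x = g ^ (i + 1) • y - g ^ i • y := fun i _ ↦ by
      rw [hx, smul_sub, smul_smul, ← pow_succ]
    rw [Finset.sum_congr rfl h4, Finset.sum_range_sub (fun i ↦ g ^ i • y), hgn]
    simp
  have h5 : x * u ∣ ∑ i ∈ Finset.range n, (g ^ i • x - x) := Finset.dvd_sum fun i _ ↦ h2 x i
  rw [Finset.sum_sub_distrib, h3, zero_sub, dvd_neg, Finset.sum_const, Finset.card_range,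
    nsmul_eq_mul, hn.dvd_mul_left] at h5
  by_contra hx0
  obtain ⟨a, ha⟩ := h5
  have h6 : x * (u * a) = x * 1 := by linear_combination -ha
  exact hu.not_isUnit (IsUnit.of_mul_eq_one _ (mul_left_cancel₀ hx0 h6))

/-- In the tame case, the Vandermonde system given by the quotients `σ(u) / u` is solvable for every
coset of the inertia group. -/
theorem exists_sum_mul_pow_eq [FaithfulSMul H U] (h : IsPurelyRamified T U) {u : U}
    (hu : Irreducible u) {n : ℕ} (hn : IsUnit (n : U)) (τ : H) (ι : Fin n → H)
    (hι : Function.Injective ι)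
    (hιT : ∀ i j, ∀ x : T, ((ι j)⁻¹ * ι i) • algebraMap T U x = algebraMap T U x)
    (hιn : ∀ i j, ((ι j)⁻¹ * ι i) ^ n = 1) (w : Fin n → U) (hw : ∀ j : Fin n, u ^ (j : ℕ) ∣ w j) :
    ∃ y : Fin n → U, ∀ j : Fin n, ∑ i, y i * ((τ * ι i) • u) ^ (j : ℕ) = w j := by
  choose w' hw' using hw
  choose a ha using fun i ↦ associated_smul hu (τ * ι i)
  -- As `(τ * ι i) • u = u * a i`, the factor `u ^ j` cancels from the `j`-th equation and leaves
  -- this matrix.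
  let A : Matrix (Fin n) (Fin n) U := Matrix.vandermonde fun i ↦ (a i : U)
  have hA : IsUnit A.det := by
    rw [Matrix.det_vandermonde, IsUnit.prod_univ_iff]
    intro i
    rw [IsUnit.prod_iff]
    intro j hj
    have hij : i ≠ j := (Finset.mem_Ioi.1 hj).ne
    by_contra hunit
    have h1 : u ∣ (a j : U) - a i := by
      have := (IsLocalRing.mem_maximalIdeal _).2 hunit
      rwa [hu.maximalIdeal_eq, Ideal.mem_span_singleton] at this
    have h2 : u * u ∣ (τ * ι j) • u - (τ * ι i) • u := by
      rw [← ha, ← ha, ← mul_sub]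
      exact mul_dvd_mul_left u h1
    have h3 : u * u ∣ ((ι i)⁻¹ * ι j) • u - u := by
      obtain ⟨c, hc⟩ := h2
      -- Applying `(τ * ι i)⁻¹` preserves the ideal of `u * u` and moves the congruence to an
      -- element fixing `T`.
      obtain ⟨v, hv⟩ := associated_smul hu (τ * ι i)⁻¹
      refine ⟨v * v * ((τ * ι i)⁻¹ • c), ?_⟩
      have h4 := congrArg ((τ * ι i)⁻¹ • ·) hc
      simp only [smul_sub, smul_mul', inv_smul_smul, ← hv] at h4
      have h5 : (τ * ι i)⁻¹ * (τ * ι j) = (ι i)⁻¹ * ι j := by group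
      rw [smul_smul, h5] at h4
      rw [h4]
      ring
    have h4 := eq_one_of_mul_self_dvd_smul_sub h hu (hιT j i) hn (hιn j i) h3
    exact hij (hι (inv_mul_eq_one.1 h4))
  refine ⟨Matrix.vecMul w' A⁻¹, fun j ↦ ?_⟩
  have h1 : Matrix.vecMul (Matrix.vecMul w' A⁻¹) A = w' := by
    rw [Matrix.vecMul_vecMul, Matrix.nonsing_inv_mul A hA, Matrix.vecMul_one]
  have h2 := congrFun h1 j
  rw [hw' j, ← h2, Matrix.vecMul, dotProduct, Finset.mul_sum]
  refine Finset.sum_congr rfl fun i _ ↦ ?_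
  rw [← ha i, mul_pow, show A i j = (a i : U) ^ (j : ℕ) from Matrix.vandermonde_apply ..]
  ring

end Tame

/-! ### Independence of characters -/

section Wedderburn

theorem wedderburn_injective (S U H : Type*) [CommRing S] [CommRing U] [IsDomain U] [Algebra S U]
    [Group H] [MulSemiringAction H U] [SMulCommClass H S U] [FaithfulSMul H U] :
    Function.Injective (wedderburn S U H) := by
  rw [injective_iff_map_eq_zero]
  intro f hf
  have hχ : Function.Injective fun g : H ↦ (MulSemiringAction.toRingHom H U g : U →* U) :=
    fun g g' hg ↦ FaithfulSMul.eq_of_smul_eq_smul (α := U) fun x ↦ DFunLike.congr_fun hg x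
  have hli := (linearIndependent_monoidHom U U).comp _ hχ
  rw [← SkewMonoidAlgebra.coeff_eq_zero]
  refine linearIndependent_iff.1 hli _ (funext fun x ↦ ?_)
  have h1 : wedderburn S U H f x = f.coeff.sum fun g y ↦ y * g • x := by
    conv_lhs => rw [← SkewMonoidAlgebra.sum_single f]
    rw [SkewMonoidAlgebra.map_sum, SkewMonoidAlgebra.sum_def', Finsupp.sum, LinearMap.sum_apply]
    exact Finset.sum_congr rfl fun g _ ↦ wedderburn_single ..
  rw [hf] at h1
  rw [Finsupp.linearCombination_apply, Finsupp.sum, Finset.sum_apply]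
  exact h1.symm

end Wedderburn

/-! ### Flatness -/

section Flat

theorem mapIncl_injective_of_isTorsionFree {R M N : Type*} [CommRing R] [IsDedekindDomain R]
    [AddCommGroup M] [AddCommGroup N] [Module R M] [Module R N] [Module.IsTorsionFree R M]
    [Module.IsTorsionFree R N] (X : Submodule R M) (Y : Submodule R N) :
    Function.Injective (TensorProduct.mapIncl X Y) :=
  TensorProduct.map_injective_of_flat_flat X.subtype Y.subtype X.injective_subtype
    Y.injective_subtype

end Flat

/-! ### Comparison of the two images under `θ` -/

section ThetaImage

variable {S T U : Type*} [CommRing S] [IsDomain S] [IsPrincipalIdealRing S] [CommRing T]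
  [IsDomain T] [IsDiscreteValuationRing T] [CommRing U] [IsDomain U] [IsDiscreteValuationRing U]
  [Algebra S T] [Algebra T U] [Algebra S U] [IsScalarTower S T U]
  [FaithfulSMul S T] [FaithfulSMul T U] [FaithfulSMul S U]
  [Module.Finite S T] [Module.Finite T U] [Module.Finite S U]

omit [IsDomain S] [IsPrincipalIdealRing S] [Algebra S T] [IsScalarTower S T U] [FaithfulSMul S T]
  [FaithfulSMul S U] [Module.Finite S T] [Module.Finite S U] in
theorem end_ext_smul_pow {n : ℕ} (hn : Module.finrank T U = n) (h : IsPurelyRamified T U) {u : U}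
    (hu : Irreducible u) {f g : Module.End S U}
    (hfg : ∀ (x : T) (j : Fin n), f (x • u ^ (j : ℕ)) = g (x • u ^ (j : ℕ))) : f = g := by
  obtain ⟨b, hb⟩ := exists_powerBasis hn h hu
  ext z
  rw [← b.sum_repr z, map_sum, map_sum]
  exact Finset.sum_congr rfl fun j _ ↦ by rw [hb, hfg]

variable {n : ℕ} {u : U} (hV : IsBaseChange T (powerSpan S u n).subtype)
  {G H : Type*} [Group G] [Group H] [MulSemiringAction G T] [MulSemiringAction H U]
  [SMulCommClass G S T] [SMulCommClass H S U]

omit [IsDiscreteValuationRing T] [IsDiscreteValuationRing U] [FaithfulSMul T U]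
  [Module.Finite T U] in
theorem theta_tmul_smul_pow (α : Module.End S T) (β : Module.End T U) (x : T) (j : Fin n) :
    theta hV (α ⊗ₜ β) (x • u ^ (j : ℕ)) = α x • β (u ^ (j : ℕ)) :=
  theta_tmul hV α β x ⟨u ^ (j : ℕ), Submodule.subset_span ⟨j, rfl⟩⟩

theorem theta_single_tmul_mem [FaithfulSMul H U] (hn : Module.finrank T U = n)
    (h : IsPurelyRamified T U) (hu : Irreducible u) (hunit : IsUnit (n : U))
    {N : Type*} [Group N] (hN : Nat.card N = n) {ι : N →* H} (hι : Function.Injective ι)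
    (hιT : ∀ (σ : N) (x : T), ι σ • algebraMap T U x = algebraMap T U x)
    {ρ : G} {τ : H} (hτ : ∀ x : T, algebraMap T U (ρ • x) = τ • algebraMap T U x) (z : T)
    {β : Module.End T U} (hβ : β ∈ triangularOrder T u) :
    theta hV (wedderburn S T G (SkewMonoidAlgebra.single ρ z) ⊗ₜ β) ∈ wedderburnImage S U H := by
  have hpos : 0 < n := hn ▸ Module.finrank_pos
  have : Finite N := Nat.finite_of_card_ne_zero (by omega)
  let e : Fin n ≃ N := (Finite.equivFinOfCardEq hN).symm
  have hpow : ∀ σ : N, σ ^ n = 1 := fun σ ↦ by rw [← hN, pow_card_eq_one']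
  have hdiv : ∀ i j, (ι (e j))⁻¹ * ι (e i) = ι ((e j)⁻¹ * e i) := fun i j ↦ by
    rw [map_mul, map_inv]
  -- The preimage is sought with support in the coset of `τ`; its `n` coefficients have to match the
  -- `n` values `z • β (u ^ j)`.
  obtain ⟨y, hy⟩ := exists_sum_mul_pow_eq h hu hunit τ (fun i ↦ ι (e i)) (hι.comp e.injective)
    (fun i j x ↦ by rw [hdiv, hιT])
    (fun i j ↦ by rw [hdiv, ← map_pow, hpow, map_one])
    (fun j ↦ z • β (u ^ (j : ℕ))) fun j ↦ by
      rw [Algebra.smul_def]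
      exact (Ideal.mem_span_singleton.1 (hβ j)).mul_left _
  refine ⟨∑ i, SkewMonoidAlgebra.single (τ * ι (e i)) (y i), ?_⟩
  change wedderburn S U H _ = _
  refine end_ext_smul_pow hn h hu fun x j ↦ ?_
  rw [theta_tmul_smul_pow, map_sum, LinearMap.sum_apply, wedderburn_single, mul_comm, mul_smul,
    ← hy, Algebra.smul_def (ρ • x), hτ, Finset.mul_sum]
  refine Finset.sum_congr rfl fun i _ ↦ ?_
  rw [wedderburn_single, Algebra.smul_def, smul_mul', mul_smul τ, hιT, smul_pow']
  ring

theorem exists_theta_tmul_eq_single (hn : Module.finrank T U = n)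
    (h : IsPurelyRamified T U) (hu : Irreducible u) {ρ : G} {τ : H}
    (hτ : ∀ x : T, algebraMap T U (ρ • x) = τ • algebraMap T U x) (y : U) :
    ∃ β ∈ triangularOrder T u,
      theta hV (wedderburn S T G (SkewMonoidAlgebra.single ρ 1) ⊗ₜ β) =
        wedderburn S U H (SkewMonoidAlgebra.single τ y) := by
  obtain ⟨b, hb⟩ := exists_powerBasis hn h hu
  -- `β` agrees with `y τ` on the power basis but is extended `T`-linearly; the factor `ρ` supplies
  -- the action of `τ` on `T`.
  let β : Module.End T U := b.constr T fun j ↦ y * (τ • u) ^ (j : ℕ)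
  have hβ : ∀ j : Fin n, β (u ^ (j : ℕ)) = y * (τ • u) ^ (j : ℕ) := fun j ↦ by
    rw [← hb, Module.Basis.constr_basis]
  refine ⟨β, (mem_triangularOrder_iff_forall_lt h hu).2 fun k hk ↦ ?_, ?_⟩
  · rw [hβ ⟨k, hn ▸ hk⟩]
    exact (pow_dvd_pow_of_dvd (associated_smul hu τ).dvd k).mul_left y
  · refine end_ext_smul_pow hn h hu fun x j ↦ ?_
    rw [theta_tmul_smul_pow, hβ, wedderburn_single, wedderburn_single, one_mul, Algebra.smul_def,
      Algebra.smul_def, hτ, smul_mul', smul_pow']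
    ring

open TransportedTensor

/-- Both sides are additively generated by the tensors and group ring elements treated above.
Surjectivity of `π` provides the lift `τ` of each `ρ`. -/
theorem map_wedderburnImage_eq_range_incl [FaithfulSMul H U] (hn : Module.finrank T U = n)
    (h : IsPurelyRamified T U) (hu : Irreducible u) (hunit : IsUnit (n : U))
    {N : Type*} [Group N] (hN : Nat.card N = n) {ι : N →* H} (hι : Function.Injective ι)
    (hιT : ∀ (σ : N) (x : T), ι σ • algebraMap T U x = algebraMap T U x)
    {π : H → G} (hπ : Function.Surjective π)
    (hπT : ∀ (τ : H) (x : T), algebraMap T U (π τ • x) = τ • algebraMap T U x) :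
    (((wedderburnImage S U H).map (thetaAlg hV).symm.toAlgHom :
        Subalgebra S (TransportedTensor hV)) : Set (TransportedTensor hV)) =
      Set.range (incl hV (wedderburnImageModule S T G) (triangularOrder T u)) := by
  have hincl : ∀ (α : wedderburnImageModule S T G) (β : triangularOrder T u),
      thetaAlg hV (incl hV _ _ (α ⊗ₜ β)) = theta hV ((α : Module.End S T) ⊗ₜ (β : Module.End T U)) :=
    fun α β ↦ rfl
  apply Set.Subset.antisymm
  · rintro _ ⟨_, ⟨f, rfl⟩, rfl⟩
    change (thetaAlg hV).symm (wedderburn S U H f) ∈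
      LinearMap.range (incl hV (wedderburnImageModule S T G) (triangularOrder T u))
    induction f using SkewMonoidAlgebra.induction_on with
    | zero => rw [map_zero, map_zero]; exact zero_mem _
    | add f g hf hg => rw [map_add, map_add]; exact add_mem hf hg
    | single τ y =>
      obtain ⟨β, hβ, hβ'⟩ := exists_theta_tmul_eq_single hV hn h hu (hπT τ) y
      refine ⟨⟨_, AlgHom.mem_range_self _ (SkewMonoidAlgebra.single (π τ) 1)⟩ ⊗ₜ ⟨β, hβ⟩, ?_⟩
      rw [AlgEquiv.eq_symm_apply, hincl]
      exact hβ'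
  · rintro _ ⟨t, rfl⟩
    change _ ∈ (wedderburnImage S U H).map (thetaAlg hV).symm.toAlgHom
    induction t using TensorProduct.induction_on with
    | zero => rw [map_zero]; exact zero_mem _
    | add s t hs ht => rw [map_add]; exact add_mem hs ht
    | tmul α β =>
      refine ⟨thetaAlg hV (incl hV _ _ (α ⊗ₜ β)), ?_, (thetaAlg hV).symm_apply_apply _⟩
      change _ ∈ wedderburnImage S U H
      rw [hincl]
      obtain ⟨⟨_, f, rfl⟩, β, hβ⟩ := α, β
      change theta hV (wedderburn S T G f ⊗ₜ β) ∈ _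
      induction f using SkewMonoidAlgebra.induction_on with
      | zero => rw [map_zero, TensorProduct.zero_tmul, LinearEquiv.map_zero]; exact zero_mem _
      | add f g hf hg =>
        rw [map_add, TensorProduct.add_tmul, LinearEquiv.map_add]
        exact add_mem hf hg
      | single ρ z =>
        obtain ⟨τ, rfl⟩ := hπ ρ
        exact theta_single_tmul_mem hV hn h hu hunit hN hι hιT (hπT τ) z hβ

omit [IsDiscreteValuationRing U] in
theorem incl_injective (X : Submodule T (Module.End S T)) (Y : Submodule T (Module.End T U)) :
    Function.Injective (incl hV X Y) :=
  mapIncl_injective_of_isTorsionFree X Y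

end ThetaImage

/-! ### The Galois action on the rings of integers -/

section GaloisAction

variable (S K L T : Type*) [CommRing S] [CommRing T] [Field K] [Field L] [Algebra S K] [Algebra T L]
  [IsFractionRing S K] [IsFractionRing T L] [Algebra S T] [Algebra K L] [Algebra S L]
  [IsScalarTower S K L] [IsScalarTower S T L] [IsIntegrallyClosed S] [IsIntegralClosure T S L]
  [Algebra.IsAlgebraic K L]

omit [IsFractionRing T L] [IsIntegrallyClosed S] in
theorem algebraMap_galAction_smul (σ : Gal(L/K)) (x : T) :
    letI := galAction S K L T
    algebraMap T L (σ • x) = σ (algebraMap T L x) :=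
  algebraMap_galRestrict_apply S σ x

omit [IsIntegrallyClosed S] in
theorem galAction_faithfulSMul :
    letI := galAction S K L T
    FaithfulSMul Gal(L/K) T := by
  let _ := galAction S K L T
  refine ⟨fun {σ τ} hστ ↦ ?_⟩
  have h : (σ : L →+* L) = (τ : L →+* L) := by
    refine IsLocalization.ringHom_ext (nonZeroDivisors T) (RingHom.ext fun x ↦ ?_)
    have h1 := congrArg (algebraMap T L) (hστ x)
    rwa [algebraMap_galAction_smul, algebraMap_galAction_smul] at h1
  exact AlgEquiv.ext fun x ↦ RingHom.congr_fun h x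

end GaloisAction

end NebeDecomposition

/-! ### The Nebe decomposition -/

open NebeDecomposition NebeDecomposition.TransportedTensor in
theorem mainTheorem9
    (S T U K L E : Type*)
    [CommRing S] [IsDomain S] [IsDiscreteValuationRing S]
    [CommRing T] [IsDomain T] [IsDiscreteValuationRing T]
    [CommRing U] [IsDomain U] [IsDiscreteValuationRing U]
    [Field K] [Field L] [Field E]
    [Algebra S T] [Algebra T U] [Algebra S U] [IsScalarTower S T U]
    [FaithfulSMul S T] [FaithfulSMul T U] [FaithfulSMul S U]
    [Module.Finite S T] [Module.Finite T U] [Module.Finite S U]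
    [Algebra S K] [IsFractionRing S K] [Algebra T L] [IsFractionRing T L]
    [Algebra U E] [IsFractionRing U E]
    [Algebra K L] [Algebra L E] [Algebra K E] [IsScalarTower K L E]
    [Algebra S L] [IsScalarTower S K L] [IsScalarTower S T L]
    [Algebra S E] [IsScalarTower S K E] [IsScalarTower S U E]
    [Algebra T E] [IsScalarTower T L E] [IsScalarTower T U E]
    [IsGalois K E] [IsGalois K L]
    (p : ℕ) [Fact p.Prime] [CharP (IsLocalRing.ResidueField S) p]
    (hST : IsPurelyRamified S T) (hTU : IsPurelyRamified T U)
    (u : U) (hu : Irreducible u)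
    (hn : ¬ p ∣ Nat.card Gal(E/L)) :
    letI : MulSemiringAction Gal(E/K) U := galAction S K E U
    letI : MulSemiringAction Gal(L/K) T := galAction S K L T
    haveI : SMulCommClass Gal(E/K) S U := galAction_smulCommClass S K E U
    haveI : SMulCommClass Gal(L/K) S T := galAction_smulCommClass S K L T
    haveI : IsGalois L E := IsGalois.tower_top_of_isGalois K L E
    have hV : IsBaseChange T (powerSpan S u (Nat.card Gal(E/L))).subtype :=
      isBaseChange_powerSpan (finrank_eq_card L E) hTU hu
    Function.Injective (wedderburn S U Gal(E/K)) ∧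
    Function.Injective
      (incl hV (wedderburnImageModule S T Gal(L/K)) (triangularOrder T u)) ∧
    (((wedderburnImage S U Gal(E/K)).map (thetaAlg hV).symm.toAlgHom :
        Subalgebra S (TransportedTensor hV)) : Set (TransportedTensor hV)) =
      Set.range (incl hV (wedderburnImageModule S T Gal(L/K)) (triangularOrder T u)) ∧
    ∃ B : Subalgebra S (TransportedTensor hV),
      (B : Set (TransportedTensor hV)) =
        Set.range (incl hV (wedderburnImageModule S T Gal(L/K)) (triangularOrder T u)) ∧
      ∃ e : SkewMonoidAlgebra U Gal(E/K) ≃ₐ[S] B,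
        ∀ x, thetaAlg hV (e x) = wedderburn S U Gal(E/K) x := by
  let _ : MulSemiringAction Gal(E/K) U := galAction S K E U
  let _ : MulSemiringAction Gal(L/K) T := galAction S K L T
  have : SMulCommClass Gal(E/K) S U := galAction_smulCommClass S K E U
  have : SMulCommClass Gal(L/K) S T := galAction_smulCommClass S K L T
  have : IsGalois L E := IsGalois.tower_top_of_isGalois K L E
  have hcard : Module.finrank T U = Nat.card Gal(E/L) := finrank_eq_card L E
  have hV : IsBaseChange T (powerSpan S u (Nat.card Gal(E/L))).subtype :=
    isBaseChange_powerSpan hcard hTU hu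
  have : FaithfulSMul Gal(E/K) U := galAction_faithfulSMul S K E U
  have hinjE : Function.Injective (algebraMap U E) := IsFractionRing.injective U E
  -- An integer prime to the residue characteristic is already a unit in `S`.
  have hunit : IsUnit ((Nat.card Gal(E/L) : ℕ) : U) := by
    have h1 : IsUnit ((Nat.card Gal(E/L) : ℕ) : S) := by
      by_contra h2
      have h3 := (IsLocalRing.residue_eq_zero_iff _).2 ((IsLocalRing.mem_maximalIdeal _).2 h2)
      rw [map_natCast, CharP.cast_eq_zero_iff _ p] at h3
      exact hn h3
    simpa using h1.map (algebraMap S U)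
  have hπT : ∀ (τ : Gal(E/K)) (x : T),
      algebraMap T U (AlgEquiv.restrictNormalHom L τ • x) = τ • algebraMap T U x := fun τ x ↦ by
    apply hinjE
    rw [algebraMap_galAction_smul S K E U, ← IsScalarTower.algebraMap_apply,
      ← IsScalarTower.algebraMap_apply, IsScalarTower.algebraMap_apply T L E,
      algebraMap_galAction_smul S K L T, IsScalarTower.algebraMap_apply T L E]
    exact AlgEquiv.restrictNormal_commutes τ L _
  have hιT : ∀ (σ : Gal(E/L)) (x : T),
      AlgEquiv.restrictScalarsHom K σ • algebraMap T U x = algebraMap T U x := fun σ x ↦ by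
    apply hinjE
    rw [algebraMap_galAction_smul S K E U, ← IsScalarTower.algebraMap_apply,
      IsScalarTower.algebraMap_apply T L E]
    exact σ.commutes _
  have hω : Function.Injective (wedderburn S U Gal(E/K)) := wedderburn_injective S U _
  have himage := map_wedderburnImage_eq_range_incl (S := S) hV hcard hTU hu hunit rfl
    (AlgEquiv.restrictScalarsHom_injective K) hιT
    (AlgEquiv.restrictNormalHom_surjective (F := K) (K₁ := L) E) hπT
  let f : SkewMonoidAlgebra U Gal(E/K) →ₐ[S] TransportedTensor hV :=
    (thetaAlg hV).symm.toAlgHom.comp (wedderburn S U Gal(E/K))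
  have hf : Function.Injective f := (thetaAlg hV).symm.injective.comp hω
  refine ⟨hω, incl_injective hV _ _, himage, f.range, ?_, AlgEquiv.ofInjective f hf, fun x ↦ ?_⟩
  · rw [← himage, AlgHom.range_comp, wedderburnImage]
  · exact (thetaAlg hV).apply_symm_apply _
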